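/- A \emph{general Dirichlet series} is a series $\sum_{n\ge 1} a_n e^{-\lambda_n s}$ with $a_n\in\mathbb{C}$, $\lambda_n\in\mathbb{R}$, for which the set of exponents $\{\lambda_n : a_n\neq 0\}$ is well ordered, i.e. each of its non-empty subsets has a least element (for example, $\lambda_n\to\infty$). Let $\mathcal{D}_s$ be the ring of all functions on the half-plane $\Re(s)>1/2$ that are sums of general Dirichlet series converging absolutely there. Let $L(s)$ be the sum, for $\Re(s)>1$, of a convergent general Dirichlet series which converges absolutely in some half-plane (this last condition is automatic for an ordinary Dirichlet series $\sum_{n\ge1} a_n n^{-s}$). Suppose that $L$ continues to a meromorphic function on $\Re(s)>1/2$ with finitely many poles, all of them on the line $\Re(s)=1$; that $L$ is of finite order, i.e. for all $1/2<\sigma_1<\sigma_2$ there is a real $A$ with $L(\sigma+it)=O(|t|^A)$ as $|t|\to\infty$, uniformly for $\sigma_1\le\sigma\le\sigma_2$; and that for each fixed $\sigma$ with $1/2<\sigma<1$ \[ \int_0^T |L(\sigma+it)|^2\,dt \ll T \qquad (T\to\infty). \] Let $P_s\in\mathcal{D}_s[X]$ be a polynomial such that the meromorphic function $P_s(L(s))$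 does not vanish identically on $\Re(s)>1/2$. Then for each $\sigma_0>1/2$ \[ N_{P(L)}(\sigma_0,T)\ll T \qquad (T\to\infty), \] where $N_{P(L)}(\sigma_0,T)$ is the number of zeros $\rho$, counted with multiplicity, of the meromorphic function $P_s(L(s))$ with $\Re(\rho)>\sigma_0$ and $0<\Im(\rho)<T$. The implied constant may depend on $L$, $P_s$ and $\sigma_0$. -/

import Mathlib

open Complex Filter Topology
open scoped ENNReal

/-- The open half-plane `Re s > 1/2`. -/
def rightHalfPlane : Set ℂ := {s | 1 / 2 < s.re}

/-- The `n`-th term `a_n e^{-λ_n s}` of a general Dirichlet series. -/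
noncomputable def gdsTerm (a : ℕ → ℂ) (lam : ℕ → ℝ) (s : ℂ) (n : ℕ) : ℂ :=
  a n * Complex.exp (-(lam n : ℂ) * s)

/-- The exponents that occur with a nonzero coefficient form a well-ordered set of reals, i.e. each
nonempty set of them has a least element. This holds in particular when `λ_n → ∞`. -/
def WellOrderedExponents (a : ℕ → ℂ) (lam : ℕ → ℝ) : Prop :=
  (lam '' Function.support a).IsWF

/-- On `Re s > 1/2` the function `f` is the sum of an absolutely convergent general Dirichlet
series: membership in the coefficient ring `𝓓_s`. (`HasSum` in `ℂ` is absolute convergence.) -/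
def IsAbsConvGDS (f : ℂ → ℂ) : Prop :=
  ∃ (a : ℕ → ℂ) (lam : ℕ → ℝ), WellOrderedExponents a lam ∧
    ∀ s ∈ rightHalfPlane, HasSum (gdsTerm a lam s) (f s)

/-- On `Re s > 1` the function `L` is the sum of a (general) Dirichlet series, in the sense of
convergence of partial sums, and the series converges absolutely in some half-plane.
For an ordinary Dirichlet series (`λ_n = log (n + 1)`) the last clause is automatic, since
convergence for `Re s > 1` gives absolute convergence for `Re s > 2`. -/
def IsDirichletSeriesRightOfOne (L : ℂ → ℂ) : Prop :=
  ∃ (a : ℕ → ℂ) (lam : ℕ → ℝ), WellOrderedExponents a lam ∧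
    (∀ s : ℂ, 1 < s.re →
      Tendsto (fun N : ℕ => ∑ n ∈ Finset.range N, gdsTerm a lam s n) atTop (𝓝 (L s))) ∧
    ∃ σa : ℝ, ∀ s : ℂ, σa < s.re → Summable (fun n => ‖gdsTerm a lam s n‖)

/-- `L` has finite order in `Re s > 1/2`: polynomial growth in `|Im s|`, uniformly in each closed
vertical strip of finite width inside the half-plane. -/
def HasFiniteOrder (L : ℂ → ℂ) : Prop :=
  ∀ σ₁ σ₂ : ℝ, 1 / 2 < σ₁ → ∃ A C t₀ : ℝ, ∀ s : ℂ,
    σ₁ ≤ s.re → s.re ≤ σ₂ → t₀ ≤ |s.im| → ‖L s‖ ≤ C * |s.im| ^ A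

/-- The function `s ↦ P_s(L(s))`. -/
noncomputable def polyComp (P : Polynomial (ℂ → ℂ)) (L : ℂ → ℂ) (s : ℂ) : ℂ :=
  (P.map (Pi.evalRingHom (fun _ : ℂ => ℂ) s)).eval (L s)

/-- Multiplicity of `ρ` as a zero of the meromorphic function `F`: the order of `F` at `ρ` if it is
nonnegative, `0` at a pole, and `⊤` if `F` vanishes identically near `ρ`. -/
noncomputable def zeroMult (F : ℂ → ℂ) (ρ : ℂ) : ℕ∞ :=
  WithTop.map Int.toNat (meromorphicOrderAt F ρ)

/-- Number of zeros `ρ` of `F`, with multiplicity, with `Re ρ > σ₀` and `0 < Im ρ < T`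
(the value is `∞` if there are infinitely many). -/
noncomputable def zeroCount (F : ℂ → ℂ) (σ₀ T : ℝ) : ℝ≥0∞ :=
  ∑' ρ : {ρ : ℂ // σ₀ < ρ.re ∧ 0 < ρ.im ∧ ρ.im < T}, ((zeroMult F ρ : ℕ∞) : ℝ≥0∞)

/-! Write F = P(L). The zeros are caught in discs of fixed radius r centred at X + in, with X far to
the right and n running through the naturals up to T. Jensen's formula bounds the number of zeros in
each disc by a constant times log(max |F| / |F(X + in)|), the maximum being over a slightly larger
concentric circle. It remains to show that these logarithms sum to O(T).

The denominators are bounded below uniformly in n: far to the right F is a general Dirichlet series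
with well-ordered exponents, and its least exponent gives a term that dominates all the others
(`IsEventuallyGDS.exists_lower_bound`). This uses only the real part of s.

For the numerators, coefficients in the ring are bounded in strips, so |F| ≤ Q(1 + |L|)^d, and log(1
+ x) ≤ x makes the logarithm at most linear in max |L|. Cauchy's theorem for L(s) exp((s - w)²) on a
tall rectangle bounds |L(w)| by a rapidly decaying average of |L| over a line Re s = a with 1/2 < a
< 1 (`exists_norm_le_centred_average`); finite order makes the horizontal sides negligible. Summed
over n, these averages cost only the first moment of |L| up to height 2T, which is O(T) by the mean
square hypothesis (`exists_sum_average_le_mul`). The poles lie below a fixed height, so the part of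
the region they can affect is compact and contributes O(1). -/

/-! ### General Dirichlet series far to the right -/

/-- The function `f` is, for `Re s` large, the sum of an absolutely convergent general Dirichlet
series whose exponents form a well-ordered set. -/
def IsEventuallyGDS (f : ℂ → ℂ) : Prop :=
  ∃ (ι : Type) (a : ι → ℂ) (lam : ι → ℝ) (σ : ℝ), (lam '' Function.support a).IsPWO ∧
    ∀ s : ℂ, σ < s.re → HasSum (fun i => a i * exp (-(lam i : ℂ) * s)) (f s)

theorem norm_exp_neg_ofReal_mul (l : ℝ) (s : ℂ) :
    ‖exp (-(l : ℂ) * s)‖ = Real.exp (-l * s.re) := by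
  rw [Complex.norm_exp]; simp

theorem IsAbsConvGDS.isEventuallyGDS {f : ℂ → ℂ} (hf : IsAbsConvGDS f) : IsEventuallyGDS f := by
  obtain ⟨a, lam, hw, h⟩ := hf
  exact ⟨ℕ, a, lam, 1 / 2, hw.isPWO, fun s hs => h s hs⟩

theorem IsDirichletSeriesRightOfOne.exists_hasSum {L : ℂ → ℂ}
    (hL : IsDirichletSeriesRightOfOne L) :
    ∃ (a : ℕ → ℂ) (lam : ℕ → ℝ) (σ : ℝ), WellOrderedExponents a lam ∧
      ∀ s : ℂ, σ < s.re → HasSum (gdsTerm a lam s) (L s) := by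
  obtain ⟨a, lam, hw, h, σa, ha⟩ := hL
  refine ⟨a, lam, max 1 σa, hw, fun s hs => ?_⟩
  have hs' := max_lt_iff.1 hs
  have hsum : Summable (gdsTerm a lam s) := (ha s hs'.2).of_norm
  have := tendsto_nhds_unique hsum.hasSum.tendsto_sum_nat (h s hs'.1)
  exact this ▸ hsum.hasSum

theorem IsEventuallyGDS.one : IsEventuallyGDS (fun _ => 1) := by
  refine ⟨Unit, fun _ => 1, fun _ => 0, 0, (Set.toFinite _).isPWO, fun s _ => ?_⟩
  simp

theorem IsEventuallyGDS.zero : IsEventuallyGDS (fun _ => 0) := by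
  refine ⟨Empty, fun _ => 1, fun _ => 0, 0, (Set.toFinite _).isPWO, fun s _ => ?_⟩
  exact hasSum_empty

theorem IsEventuallyGDS.add {f g : ℂ → ℂ} (hf : IsEventuallyGDS f) (hg : IsEventuallyGDS g) :
    IsEventuallyGDS (fun s => f s + g s) := by
  obtain ⟨ι, a, lam, σ, hw, h⟩ := hf
  obtain ⟨κ, b, mu, τ, hw', h'⟩ := hg
  refine ⟨ι ⊕ κ, Sum.elim a b, Sum.elim lam mu, max σ τ, ?_, fun s hs => ?_⟩
  · refine (hw.union hw').mono ?_
    rintro _ ⟨i | i, hi, rfl⟩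
    · exact Or.inl ⟨i, hi, rfl⟩
    · exact Or.inr ⟨i, hi, rfl⟩
  · have hs' := max_lt_iff.1 hs
    exact HasSum.sum (h s hs'.1) (h' s hs'.2)

/-- Exponents of a product lie in the sumset of two well-ordered sets, which is again well ordered;
`IsPWO` is the form that is stable under sums. The free index type makes room for the product index.
-/
theorem IsEventuallyGDS.mul {f g : ℂ → ℂ} (hf : IsEventuallyGDS f) (hg : IsEventuallyGDS g) :
    IsEventuallyGDS (fun s => f s * g s) := by
  obtain ⟨ι, a, lam, σ, hw, h⟩ := hf
  obtain ⟨κ, b, mu, τ, hw', h'⟩ := hg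
  refine ⟨ι × κ, fun p => a p.1 * b p.2, fun p => lam p.1 + mu p.2, max σ τ, ?_, fun s hs => ?_⟩
  · refine (hw.add hw').mono ?_
    rintro _ ⟨p, hp, rfl⟩
    have hp' : a p.1 ≠ 0 ∧ b p.2 ≠ 0 := by simpa using hp
    exact Set.add_mem_add (Set.mem_image_of_mem lam hp'.1) (Set.mem_image_of_mem mu hp'.2)
  · have hs' := max_lt_iff.1 hs
    have h1 := h s hs'.1
    have h2 := h' s hs'.2
    have h3 := summable_mul_of_summable_norm (f := fun i => a i * exp (-(lam i : ℂ) * s))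
      (g := fun j => b j * exp (-(mu j : ℂ) * s)) h1.summable.norm h2.summable.norm
    have := h1.mul h2 h3
    refine this.congr_fun fun p => ?_
    push_cast
    rw [neg_add, add_mul, Complex.exp_add]
    ring

theorem IsEventuallyGDS.pow {f : ℂ → ℂ} (hf : IsEventuallyGDS f) (k : ℕ) :
    IsEventuallyGDS (fun s => f s ^ k) := by
  induction k with
  | zero => simpa using IsEventuallyGDS.one
  | succ k ih => simpa only [pow_succ] using ih.mul hf

theorem IsEventuallyGDS.sum {α : Type*} (t : Finset α) {f : α → ℂ → ℂ}
    (hf : ∀ k ∈ t, IsEventuallyGDS (f k)) : IsEventuallyGDS (fun s => ∑ k ∈ t, f k s) := by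
  classical
  induction t using Finset.induction_on with
  | empty => simpa using IsEventuallyGDS.zero
  | insert k t hk ih =>
    simp only [Finset.sum_insert hk]
    exact (hf k (Finset.mem_insert_self k t)).add
      (ih fun j hj => hf j (Finset.mem_insert_of_mem hj))

theorem polyComp_eq_sum (P : Polynomial (ℂ → ℂ)) (L : ℂ → ℂ) (s : ℂ) :
    polyComp P L s = ∑ k ∈ Finset.range (P.natDegree + 1), P.coeff k s * L s ^ k := by
  rw [polyComp, Polynomial.eval_map, Polynomial.eval₂_eq_sum_range]
  rfl

/-- Terms with equal exponents can be collected. -/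
theorem IsEventuallyGDS.exists_distinct {f : ℂ → ℂ} (hf : IsEventuallyGDS f) :
    ∃ (b : ℝ → ℂ) (σ : ℝ), (Function.support b).IsWF ∧
      ∀ s : ℂ, σ < s.re → HasSum (fun μ : ℝ => b μ * exp (-(μ : ℂ) * s)) (f s) := by
  obtain ⟨ι, a, lam, σ, hw, h⟩ := hf
  refine ⟨fun μ => ∑' i : {i // lam i = μ}, a i, σ, ?_, fun s hs => ?_⟩
  · refine hw.isWF.mono fun μ hμ => ?_
    by_contra hcon
    refine hμ ?_
    have : ∀ i : {i // lam i = μ}, a i = 0 := fun i => by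
      by_contra hi
      exact hcon ⟨i, hi, i.2⟩
    simp [this]
  -- Absolute convergence allows summation first over each fibre of `lam`, where the exponential is
  -- constant.
  · have h1 := (Equiv.sigmaFiberEquiv lam).hasSum_iff.2 (h s hs)
    have h2 := h1.sigma (g := fun μ => ∑' i : {i // lam i = μ}, a i * exp (-(lam i : ℂ) * s))
      (fun μ => (h1.summable.sigma_factor μ).hasSum)
    refine h2.congr_fun fun μ => ?_
    rw [← tsum_mul_right]
    refine tsum_congr fun i => ?_
    rw [i.2]

/-- A general Dirichlet series that does not vanish identically is bounded below, far to the right,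
by its leading term. -/
theorem IsEventuallyGDS.exists_lower_bound {f : ℂ → ℂ} (hf : IsEventuallyGDS f)
    (hne : ∀ σ : ℝ, ∃ s : ℂ, σ < s.re ∧ f s ≠ 0) :
    ∃ (c μ σ : ℝ), 0 < c ∧ ∀ s : ℂ, σ ≤ s.re → c * Real.exp (-μ * s.re) ≤ ‖f s‖ := by
  obtain ⟨b, σ, hw, h⟩ := hf.exists_distinct
  have hsupp : (Function.support b).Nonempty := by
    by_contra hcon
    rw [Set.not_nonempty_iff_eq_empty, Function.support_eq_empty_iff] at hcon
    obtain ⟨s, hs, hfs⟩ := hne σ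
    have := h s hs
    simp only [hcon, Pi.zero_apply, zero_mul] at this
    exact hfs (this.unique hasSum_zero)
  set μ₀ := hw.min hsupp with hμ₀
  have hb0 : b μ₀ ≠ 0 := hw.min_mem hsupp
  have hmin : ∀ μ, b μ ≠ 0 → μ₀ ≤ μ := fun μ hμ => hw.min_le hsupp hμ
  set τ := σ + 1 with hτ
  have hsum : ∀ x : ℝ, τ ≤ x → Summable (fun μ : ℝ => ‖b μ‖ * Real.exp (-μ * x)) := fun x hx => by
    have := (h (x : ℂ) (by simp; linarith)).summable.norm
    refine this.congr fun μ => ?_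
    rw [norm_mul, norm_exp_neg_ofReal_mul, ofReal_re]
  -- the part of the series beyond the leading term, normalised by it
  set r : ℝ → ℝ → ℝ := fun x μ => if μ = μ₀ then 0 else ‖b μ‖ * Real.exp (-(μ - μ₀) * x) with hr
  have hr0 : ∀ x μ, 0 ≤ r x μ := fun x μ => by simp only [hr]; split_ifs <;> positivity
  have hrle : ∀ x, τ ≤ x → ∀ μ, r x μ ≤ r τ μ := fun x hx μ => by
    simp only [hr]
    split_ifs with hμ
    · exact le_rfl
    · by_cases hbμ : b μ = 0
      · simp [hbμ]
      · have := hmin μ hbμ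
        gcongr ‖b μ‖ * Real.exp ?_
        nlinarith
  have hrsum : Summable (r τ) := by
    refine Summable.of_nonneg_of_le (hr0 τ) (fun μ => ?_)
      ((hsum τ le_rfl).mul_right (Real.exp (μ₀ * τ)))
    simp only [hr]
    split_ifs
    · positivity
    · rw [mul_assoc, ← Real.exp_add]
      gcongr
      linarith
  -- Every other exponent exceeds `μ₀`, so each normalised term decays as x grows, dominated by its
  -- value at `τ`; the whole remainder tends to 0.
  have htend : Tendsto (fun x => ∑' μ, r x μ) atTop (𝓝 (∑' _ : ℝ, (0 : ℝ))) := by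
    refine tendsto_tsum_of_dominated_convergence hrsum (fun μ => ?_) ?_
    · simp only [hr]
      by_cases hμ : μ = μ₀
      · simp [hμ]
      by_cases hbμ : b μ = 0
      · simp [hbμ]
      · simp only [hμ, if_false]
        have hlt : 0 < μ - μ₀ := sub_pos.2 (lt_of_le_of_ne (hmin μ hbμ) (Ne.symm hμ))
        have : Tendsto (fun x : ℝ => Real.exp (-(μ - μ₀) * x)) atTop (𝓝 0) :=
          Real.tendsto_exp_atBot.comp (tendsto_id.const_mul_atTop_of_neg (by linarith))
        simpa using this.const_mul ‖b μ‖
    · filter_upwards [eventually_ge_atTop τ] with x hx μ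
      rw [Real.norm_of_nonneg (hr0 x μ)]
      exact hrle x hx μ
  rw [tsum_zero] at htend
  have hbpos : 0 < ‖b μ₀‖ := norm_pos_iff.2 hb0
  obtain ⟨σ₂, hσ₂⟩ := eventually_atTop.1 (htend.eventually_lt_const (half_pos hbpos))
  refine ⟨‖b μ₀‖ / 2, μ₀, max τ σ₂, half_pos hbpos, fun s hs => ?_⟩
  have hs1 : τ ≤ s.re := (le_max_left _ _).trans hs
  have hs2 := hσ₂ s.re ((le_max_right _ _).trans hs)
  have h1 := h s (by linarith)
  -- The series with its leading term deleted; its norm is at most half of that term.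
  have h2 := h1.update μ₀ 0
  have hrs : Summable (r s.re) := Summable.of_nonneg_of_le (hr0 _) (hrle _ hs1) hrsum
  have h3 := hrs.mul_right (Real.exp (-μ₀ * s.re))
  have h4 : ‖0 - b μ₀ * exp (-(μ₀ : ℂ) * s) + f s‖
      ≤ ∑' μ, r s.re μ * Real.exp (-μ₀ * s.re) := by
    rw [← h2.tsum_eq]
    refine tsum_of_norm_bounded h3.hasSum fun μ => ?_
    by_cases hμ : μ = μ₀
    · simp [hμ, hr]
    · rw [Function.update_of_ne hμ, norm_mul, norm_exp_neg_ofReal_mul]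
      simp only [hr, hμ, if_false]
      rw [mul_assoc, ← Real.exp_add]
      refine le_of_eq ?_
      ring_nf
  rw [tsum_mul_right] at h4
  have h5 : ‖b μ₀ * exp (-(μ₀ : ℂ) * s)‖ = ‖b μ₀‖ * Real.exp (-μ₀ * s.re) := by
    rw [norm_mul, norm_exp_neg_ofReal_mul]
  have h6 : ‖b μ₀ * exp (-(μ₀ : ℂ) * s)‖
      ≤ ‖f s‖ + ‖0 - b μ₀ * exp (-(μ₀ : ℂ) * s) + f s‖ := by
    calc _ = ‖f s - (0 - b μ₀ * exp (-(μ₀ : ℂ) * s) + f s)‖ := by congr 1; ring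
      _ ≤ _ := norm_sub_le _ _
  have h7 : (∑' μ, r s.re μ) * Real.exp (-μ₀ * s.re)
      ≤ ‖b μ₀‖ / 2 * Real.exp (-μ₀ * s.re) := by gcongr
  linarith

/-! ### Boundedness and holomorphy in strips -/

/-- The modulus of a term is monotone in Re s, in a direction set by the sign of the exponent.
Negative exponents may occur, so the majorant adds the values on both edges. -/
theorem summable_gds_strip {ι : Type*} {a : ι → ℂ} {lam : ι → ℝ} {σ₁ σ₂ : ℝ}
    (h₁ : Summable fun i => a i * exp (-(lam i : ℂ) * σ₁))
    (h₂ : Summable fun i => a i * exp (-(lam i : ℂ) * σ₂)) :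
    ∃ u : ι → ℝ, Summable u ∧ ∀ s : ℂ, σ₁ ≤ s.re → s.re ≤ σ₂ → ∀ i,
      ‖a i * exp (-(lam i : ℂ) * s)‖ ≤ u i := by
  refine ⟨_, h₁.norm.add h₂.norm, fun s hs1 hs2 i => ?_⟩
  simp only [norm_mul, norm_exp_neg_ofReal_mul, ofReal_re]
  rw [← mul_add]
  gcongr
  rcases le_total 0 (lam i) with hl | hl
  · have : Real.exp (-lam i * s.re) ≤ Real.exp (-lam i * σ₁) :=
      Real.exp_le_exp.2 (by nlinarith)
    linarith [Real.exp_pos (-lam i * σ₂)]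
  · have : Real.exp (-lam i * s.re) ≤ Real.exp (-lam i * σ₂) :=
      Real.exp_le_exp.2 (by nlinarith)
    linarith [Real.exp_pos (-lam i * σ₁)]

/-- An absolutely convergent general Dirichlet series is bounded in closed vertical strips. -/
theorem exists_norm_le_of_hasSum_gds {f : ℂ → ℂ} {a : ℕ → ℂ} {lam : ℕ → ℝ} {σ : ℝ}
    (h : ∀ s : ℂ, σ < s.re → HasSum (gdsTerm a lam s) (f s)) {σ₁ : ℝ} (h1 : σ < σ₁) (σ₂ : ℝ) :
    ∃ M : ℝ, ∀ s : ℂ, σ₁ ≤ s.re → s.re ≤ σ₂ → ‖f s‖ ≤ M := by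
  rcases lt_or_ge σ₂ σ₁ with h12 | h12
  · exact ⟨0, fun s hs hs' => absurd (hs.trans hs') (not_le.2 h12)⟩
  obtain ⟨u, hu, hb⟩ := summable_gds_strip (h σ₁ (by simpa)).summable
    (h σ₂ (by simpa using h1.trans_le h12)).summable
  refine ⟨∑' i, u i, fun s hs hs' => ?_⟩
  rw [← (h s (h1.trans_le hs)).tsum_eq]
  exact tsum_of_norm_bounded hu.hasSum (hb s hs hs')

theorem IsAbsConvGDS.differentiableOn {f : ℂ → ℂ} (hf : IsAbsConvGDS f) :
    DifferentiableOn ℂ f rightHalfPlane := by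
  obtain ⟨a, lam, -, h⟩ := hf
  intro s hs
  have hs' : 1 / 2 < s.re := hs
  set σ₁ := (1 / 2 + s.re) / 2
  have h1 : 1 / 2 < σ₁ := by simp only [σ₁]; linarith
  have h2 : σ₁ < s.re := by simp only [σ₁]; linarith
  have hmem : ∀ x : ℝ, 1 / 2 < x → (x : ℂ) ∈ rightHalfPlane := fun x hx => by
    simpa [rightHalfPlane] using hx
  obtain ⟨u, hu, hb⟩ := summable_gds_strip (h σ₁ (hmem _ h1)).summable
    (h ((s.re + 1 : ℝ) : ℂ) (hmem _ (by linarith))).summable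
  set U : Set ℂ := {z | σ₁ < z.re ∧ z.re < s.re + 1}
  have hU : IsOpen U := (isOpen_lt continuous_const continuous_re).inter
    (isOpen_lt continuous_re continuous_const)
  have hd : DifferentiableOn ℂ (fun z => ∑' i, gdsTerm a lam z i) U :=
    differentiableOn_tsum_of_summable_norm hu
      (fun i => by unfold gdsTerm; fun_prop) hU (fun i z hz => hb z hz.1.le hz.2.le i)
  have hsU : U ∈ 𝓝 s := hU.mem_nhds ⟨h2, by linarith⟩
  refine ((hd.congr fun z hz => ?_).differentiableAt hsU).differentiableWithinAt
  exact (h z (h1.trans hz.1)).tsum_eq.symm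

/-! ### Cauchy's inequality on rectangles -/

section Rectangle

variable {a b c d : ℝ} {w : ℂ}

theorem horizontal_sub_ne_zero (h : c ≠ w.im) (x : ℝ) : (x : ℂ) + c * I - w ≠ 0 := fun h0 => by
  have := congrArg Complex.im h0
  simp at this
  exact h (by linarith)

theorem vertical_sub_ne_zero (h : a ≠ w.re) (y : ℝ) : (a : ℂ) + y * I - w ≠ 0 := fun h0 => by
  have := congrArg Complex.re h0
  simp at this
  exact h (by linarith)

theorem continuous_horizontal_inv (h : c ≠ w.im) :
    Continuous fun x : ℝ => ((x : ℂ) + c * I - w)⁻¹ :=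
  Continuous.inv₀ (by fun_prop) (horizontal_sub_ne_zero h)

theorem continuous_vertical_inv (h : a ≠ w.re) :
    Continuous fun y : ℝ => ((a : ℂ) + y * I - w)⁻¹ :=
  Continuous.inv₀ (by fun_prop) (vertical_sub_ne_zero h)

theorem im_integral_horizontal_inv (h : c ≠ w.im) :
    (∫ x in a..b, ((x : ℂ) + c * I - w)⁻¹).im
      = ∫ x in a..b, (w.im - c) / normSq ((x : ℂ) + c * I - w) := by
  rw [← imCLM_apply,
    ← imCLM.intervalIntegral_comp_comm ((continuous_horizontal_inv h).intervalIntegrable a b)]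
  refine intervalIntegral.integral_congr fun x _ => ?_
  simp [Complex.inv_im]

theorem re_integral_vertical_inv (h : a ≠ w.re) :
    (∫ y in c..d, ((a : ℂ) + y * I - w)⁻¹).re
      = ∫ y in c..d, (a - w.re) / normSq ((a : ℂ) + y * I - w) := by
  rw [← reCLM_apply,
    ← reCLM.intervalIntegral_comp_comm ((continuous_vertical_inv h).intervalIntegrable c d)]
  refine intervalIntegral.integral_congr fun x _ => ?_
  simp [Complex.inv_re]

/-- The integral of `(z - w)⁻¹` over the boundary of a rectangle around `w` stays away from `0`. -/
theorem le_im_boundary_integral_inv (ha : a < w.re) (hb : w.re < b) (hc : c < w.im)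
    (hd : w.im + 1 ≤ d) :
    (b - w.re) / ((b - w.re) ^ 2 + 1) ≤
      ((∫ x in a..b, ((x : ℂ) + c * I - w)⁻¹) - (∫ x in a..b, ((x : ℂ) + d * I - w)⁻¹)
        + I * (∫ y in c..d, ((b : ℂ) + y * I - w)⁻¹)
        - I * ∫ y in c..d, ((a : ℂ) + y * I - w)⁻¹).im := by
  have hab : a ≤ b := by linarith
  have hcd : c ≤ d := by linarith
  simp only [sub_im, add_im, I_mul_im]
  rw [im_integral_horizontal_inv hc.ne, im_integral_horizontal_inv (by linarith : w.im < d).ne',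
    re_integral_vertical_inv hb.ne', re_integral_vertical_inv ha.ne]
  -- Each side contributes the nonnegative angle it subtends at `w`. Only the piece of the right
  -- side at heights from `w.im` to `w.im + 1` is kept.
  have h1 : 0 ≤ ∫ x in a..b, (w.im - c) / normSq ((x : ℂ) + c * I - w) :=
    intervalIntegral.integral_nonneg hab fun x _ => div_nonneg (by linarith) (normSq_nonneg _)
  have h2 : (∫ x in a..b, (w.im - d) / normSq ((x : ℂ) + d * I - w)) ≤ 0 := by
    rw [intervalIntegral.integral_of_le hab]
    exact MeasureTheory.integral_nonpos fun x =>
      div_nonpos_of_nonpos_of_nonneg (by linarith) (normSq_nonneg _)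
  have h3 : (∫ y in c..d, (a - w.re) / normSq ((a : ℂ) + y * I - w)) ≤ 0 := by
    rw [intervalIntegral.integral_of_le hcd]
    exact MeasureTheory.integral_nonpos fun x =>
      div_nonpos_of_nonpos_of_nonneg (by linarith) (normSq_nonneg _)
  have hcont : Continuous fun y : ℝ => (b - w.re) / normSq ((b : ℂ) + y * I - w) := by
    refine continuous_const.div ?_ fun y => ?_
    · exact continuous_normSq.comp (by fun_prop)
    · exact normSq_eq_zero.not.2 (vertical_sub_ne_zero hb.ne' y)
  have h4 : (∫ y in w.im..(w.im + 1), (b - w.re) / normSq ((b : ℂ) + y * I - w))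
      ≤ ∫ y in c..d, (b - w.re) / normSq ((b : ℂ) + y * I - w) := by
    refine intervalIntegral.integral_mono_interval hc.le (by linarith) hd ?_
      (hcont.intervalIntegrable _ _)
    exact Eventually.of_forall fun y => div_nonneg (by linarith) (normSq_nonneg _)
  have h5 : (∫ _ in w.im..(w.im + 1), (b - w.re) / ((b - w.re) ^ 2 + 1))
      ≤ ∫ y in w.im..(w.im + 1), (b - w.re) / normSq ((b : ℂ) + y * I - w) := by
    refine intervalIntegral.integral_mono_on (by linarith) intervalIntegrable_const
      (hcont.intervalIntegrable _ _) fun y hy => ?_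
    have hpos := normSq_pos.2 (vertical_sub_ne_zero hb.ne' y)
    refine div_le_div_of_nonneg_left (by linarith) hpos ?_
    simp only [normSq_apply, sub_re, add_re, ofReal_re, mul_re, I_re, I_im, ofReal_im, sub_im,
      add_im, mul_im]
    nlinarith [hy.1, hy.2]
  simp only [intervalIntegral.integral_const, smul_eq_mul] at h5
  linarith

/-- A form of Cauchy's inequality on rectangles. -/
theorem norm_le_boundary_integral {f : ℂ → ℂ} (ha : a < w.re) (hb : w.re < b) (hc : c + 1 ≤ w.im)
    (hd : w.im + 1 ≤ d) (hf : DifferentiableOn ℂ f (Set.uIcc a b ×ℂ Set.uIcc c d)) :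
    (b - w.re) / ((b - w.re) ^ 2 + 1) * ‖f w‖ ≤
      (∫ x in a..b, ‖f (x + c * I)‖) + (∫ x in a..b, ‖f (x + d * I)‖)
        + (b - w.re)⁻¹ * (∫ y in c..d, ‖f (b + y * I)‖)
        + (w.re - a)⁻¹ * ∫ y in c..d, ‖f (a + y * I)‖ := by
  have hab : a ≤ b := by linarith
  have hcd : c ≤ d := by linarith
  have hcw : c ≠ w.im := by intro h; linarith
  have hdw : d ≠ w.im := by intro h; linarith
  have hnhds : Set.uIcc a b ×ℂ Set.uIcc c d ∈ 𝓝 w := by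
    refine mem_of_superset ((isOpen_Ioo (a := a) (b := b)).reProdIm
      (isOpen_Ioo (a := c) (b := d)) |>.mem_nhds ?_) (fun z hz => ⟨?_, ?_⟩)
    · exact ⟨⟨ha, hb⟩, ⟨by show c < w.im; linarith, by show w.im < d; linarith⟩⟩
    · rw [Set.uIcc_of_le hab]; exact Set.Ioo_subset_Icc_self hz.1
    · rw [Set.uIcc_of_le hcd]; exact Set.Ioo_subset_Icc_self hz.2
  -- The quotient (f(z) - f(w))/(z - w) extends holomorphically over `w`, so Cauchy's theorem yields
  -- the integral formula without a residue; a lower bound for the kernel integral `K` replaces the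
  -- value 2πi.
  have hg := integral_boundary_rect_eq_zero_of_differentiableOn (dslope f w)
    ((a : ℂ) + c * I) ((b : ℂ) + d * I)
    (by simpa using (differentiableOn_dslope hnhds).2 hf)
  simp only [add_re, ofReal_re, mul_re, I_re, mul_zero, ofReal_im, I_im, mul_one, sub_self,
    add_zero, add_im, mul_im, zero_add, smul_eq_mul] at hg
  have hfc := hf.continuousOn
  -- restrictions of `f` to the sides
  have hH : ∀ e ∈ Set.uIcc c d, ContinuousOn (fun x : ℝ => f (x + e * I)) (Set.uIcc a b) :=
    fun e he => hfc.comp (by fun_prop) fun x hx => ⟨by simpa using hx, by simpa using he⟩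
  have hV : ∀ e ∈ Set.uIcc a b, ContinuousOn (fun y : ℝ => f (e + y * I)) (Set.uIcc c d) :=
    fun e he => hfc.comp (by fun_prop) fun x hx => ⟨by simpa using he, by simpa using hx⟩
  have hHi : ∀ e ∈ Set.uIcc c d, e ≠ w.im →
      (∫ x in a..b, dslope f w (x + e * I))
        = (∫ x in a..b, ((x : ℂ) + e * I - w)⁻¹ * f (x + e * I))
          - (∫ x in a..b, ((x : ℂ) + e * I - w)⁻¹) * f w := fun e he hew => by
    have hi := (continuous_horizontal_inv hew)
    rw [← intervalIntegral.integral_mul_const, ← intervalIntegral.integral_sub]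
    · refine intervalIntegral.integral_congr fun x _ => ?_
      rw [dslope_of_ne _ (sub_ne_zero.1 (horizontal_sub_ne_zero hew x)), slope_def_module,
        smul_eq_mul]
      ring
    · exact (hi.continuousOn.mul (hH e he)).intervalIntegrable
    · exact (hi.mul continuous_const).intervalIntegrable _ _
  have hVi : ∀ e ∈ Set.uIcc a b, e ≠ w.re →
      (∫ y in c..d, dslope f w (e + y * I))
        = (∫ y in c..d, ((e : ℂ) + y * I - w)⁻¹ * f (e + y * I))
          - (∫ y in c..d, ((e : ℂ) + y * I - w)⁻¹) * f w := fun e he hew => by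
    have hi := (continuous_vertical_inv hew)
    rw [← intervalIntegral.integral_mul_const, ← intervalIntegral.integral_sub]
    · refine intervalIntegral.integral_congr fun x _ => ?_
      rw [dslope_of_ne _ (sub_ne_zero.1 (vertical_sub_ne_zero hew x)), slope_def_module,
        smul_eq_mul]
      ring
    · exact (hi.continuousOn.mul (hV e he)).intervalIntegrable
    · exact (hi.mul continuous_const).intervalIntegrable _ _
  have hHn : ∀ e ∈ Set.uIcc c d, 1 ≤ |e - w.im| →
      ‖∫ x in a..b, ((x : ℂ) + e * I - w)⁻¹ * f (x + e * I)‖ ≤ ∫ x in a..b, ‖f (x + e * I)‖ :=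
    fun e he hew => by
    refine intervalIntegral.norm_integral_le_of_norm_le hab (Eventually.of_forall fun x _ => ?_)
      (hH e he).norm.intervalIntegrable
    rw [norm_mul, norm_inv]
    have : 1 ≤ ‖(x : ℂ) + e * I - w‖ := by
      refine hew.trans ?_
      simpa using abs_im_le_norm ((x : ℂ) + e * I - w)
    exact mul_le_of_le_one_left (norm_nonneg _) (inv_le_one_of_one_le₀ this)
  have hVn : ∀ e ∈ Set.uIcc a b, e ≠ w.re →
      ‖∫ y in c..d, ((e : ℂ) + y * I - w)⁻¹ * f (e + y * I)‖
        ≤ |e - w.re|⁻¹ * ∫ y in c..d, ‖f (e + y * I)‖ :=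
    fun e he hew => by
    rw [← intervalIntegral.integral_const_mul]
    refine intervalIntegral.norm_integral_le_of_norm_le hcd (Eventually.of_forall fun y _ => ?_)
      ((hV e he).norm.intervalIntegrable.const_mul _)
    rw [norm_mul, norm_inv]
    have h1 : 0 < |e - w.re| := abs_pos.2 (sub_ne_zero.2 hew)
    have : |e - w.re| ≤ ‖(e : ℂ) + y * I - w‖ := by
      simpa using abs_re_le_norm ((e : ℂ) + y * I - w)
    gcongr
  have e1 := Set.left_mem_uIcc (a := c) (b := d)
  have e2 := Set.right_mem_uIcc (a := c) (b := d)
  have e3 := Set.left_mem_uIcc (a := a) (b := b)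
  have e4 := Set.right_mem_uIcc (a := a) (b := b)
  rw [hHi c e1 hcw, hHi d e2 hdw, hVi a e3 ha.ne, hVi b e4 hb.ne'] at hg
  have n1 := hHn c e1 (by rw [abs_of_nonpos] <;> linarith)
  have n2 := hHn d e2 (by rw [abs_of_nonneg] <;> linarith)
  have n3 := hVn a e3 ha.ne
  have n4 := hVn b e4 hb.ne'
  rw [abs_of_neg (by linarith), neg_sub] at n3
  rw [abs_of_pos (by linarith)] at n4
  have hm := le_im_boundary_integral_inv ha hb (by linarith : c < w.im) hd
  set K := (∫ x in a..b, ((x : ℂ) + c * I - w)⁻¹) - (∫ x in a..b, ((x : ℂ) + d * I - w)⁻¹)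
        + I * (∫ y in c..d, ((b : ℂ) + y * I - w)⁻¹)
        - I * ∫ y in c..d, ((a : ℂ) + y * I - w)⁻¹ with hK
  set A₁ := ∫ x in a..b, ((x : ℂ) + c * I - w)⁻¹ * f (x + c * I)
  set A₂ := ∫ x in a..b, ((x : ℂ) + d * I - w)⁻¹ * f (x + d * I)
  set A₃ := ∫ y in c..d, ((a : ℂ) + y * I - w)⁻¹ * f (a + y * I)
  set A₄ := ∫ y in c..d, ((b : ℂ) + y * I - w)⁻¹ * f (b + y * I)
  have hid : K * f w = A₁ - A₂ + I * A₄ - I * A₃ := by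
    rw [hK]; linear_combination -hg
  calc _ ≤ ‖K‖ * ‖f w‖ := by
        gcongr
        exact hm.trans ((le_abs_self _).trans (abs_im_le_norm K))
    _ = ‖A₁ - A₂ + I * A₄ - I * A₃‖ := by rw [← norm_mul, hid]
    _ ≤ ‖A₁‖ + ‖A₂‖ + ‖I * A₄‖ + ‖I * A₃‖ :=
        (norm_sub_le _ _).trans (add_le_add_left ((norm_add_le _ _).trans
          (add_le_add_left (norm_sub_le _ _) _)) _)
    _ ≤ _ := by
        rw [norm_mul, norm_mul, norm_I, one_mul, one_mul]
        gcongr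

end Rectangle

/-! ### Pointwise values of L from averages on a vertical line -/

theorem norm_exp_sq (z : ℂ) : ‖exp (z ^ 2)‖ = Real.exp (z.re ^ 2 - z.im ^ 2) := by
  rw [Complex.norm_exp, pow_two, mul_re, pow_two, pow_two]

/-- A power times a Gaussian is eventually small. -/
theorem eventually_mul_rpow_mul_exp_neg_sq_le (C A : ℝ) {b : ℝ} (hb : 0 < b) :
    ∀ᶠ x : ℝ in atTop, C * x ^ A * Real.exp (-b * x ^ 2) ≤ 1 := by
  have h : Tendsto (fun x : ℝ => x ^ A * Real.exp (-b * x ^ 2)) atTop (𝓝 0) := by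
    refine (rpow_mul_exp_neg_mul_sq_isLittleO_exp_neg hb A).isBigO.trans_tendsto ?_
    exact Real.tendsto_exp_atBot.comp (tendsto_id.const_mul_atTop_of_neg (by norm_num))
  have h' := h.const_mul C
  rw [mul_zero] at h'
  filter_upwards [h'.eventually_le_const one_pos] with x hx
  rwa [mul_assoc]

/-- A function of polynomial growth in a vertical strip which is bounded on the right edge is
controlled inside by a local average over the left edge. -/
theorem exists_norm_le_local_average {L : ℂ → ℂ} {a b σ₁ σ₂ τ A C M : ℝ} (ha : a < σ₁)
    (h12 : σ₁ ≤ σ₂) (hb : σ₂ < b)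
    (hdiff : ∀ s : ℂ, a ≤ s.re → τ ≤ s.im → DifferentiableAt ℂ L s)
    (hgrowth : ∀ s : ℂ, a ≤ s.re → s.re ≤ b → τ ≤ |s.im| → ‖L s‖ ≤ C * |s.im| ^ A)
    (hright : ∀ y : ℝ, ‖L (b + y * I)‖ ≤ M)
    (hcont : Continuous fun y : ℝ => L (a + y * I)) :
    ∃ K y₀ : ℝ, 0 ≤ K ∧ ∀ w : ℂ, σ₁ ≤ w.re → w.re ≤ σ₂ → y₀ ≤ w.im →
      ‖L w‖ ≤ K * (1 + ∫ y in (w.im / 2)..(3 / 2 * w.im),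
        (‖L (a + y * I)‖ + 1) * Real.exp (-(y - w.im) ^ 2)) := by
  -- The horizontal sides are at heights e = v/2 and e = 3v/2, where (e - v)² is e² and e²/9; the
  -- second value dictates 1/9.
  obtain ⟨τ₁, hτ₁⟩ := eventually_atTop.1
    (eventually_mul_rpow_mul_exp_neg_sq_le C A (b := 1 / 9) (by norm_num))
  -- Bounds the factor exp((Re(s - w))²) of the Gaussian throughout the strip.
  set E := Real.exp ((b - a) ^ 2) with hE
  have hEpos : 0 < E := Real.exp_pos _
  -- A lower bound, uniform in `w`, for the constant in `norm_le_boundary_integral`.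
  set m := (b - σ₂) / ((b - a) ^ 2 + 1) with hm
  have hmpos : 0 < m := div_pos (by linarith) (by positivity)
  have hM : 0 ≤ M := (norm_nonneg _).trans (hright 0)
  have p1 : 0 < b - σ₂ := by linarith
  have p2 : 0 < σ₁ - a := by linarith
  have p3 : 0 < b - a := by linarith
  set K₁ := (b - a) * E + (b - a) * E with hK₁
  set K₂ := (b - σ₂)⁻¹ * (M * E) + (σ₁ - a)⁻¹ * E with hK₂
  have hK₁0 : 0 ≤ K₁ := by positivity
  have hK₂0 : 0 ≤ K₂ := by positivity
  refine ⟨(K₁ + K₂) / m, max 2 (max (2 * τ) (2 * τ₁)), by positivity, fun w hw1 hw2 hw3 => ?_⟩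
  set v := w.im with hv
  have hv2 : 2 ≤ v := (le_max_left _ _).trans hw3
  have hvτ : 2 * τ ≤ v := (le_max_left _ _).trans ((le_max_right _ _).trans hw3)
  have hvτ₁ : 2 * τ₁ ≤ v := (le_max_right _ _).trans ((le_max_right _ _).trans hw3)
  have hcd : v / 2 ≤ 3 / 2 * v := by linarith
  have hab : a ≤ b := by linarith
  set J := ∫ y in (v / 2)..(3 / 2 * v), (‖L (a + y * I)‖ + 1) * Real.exp (-(y - v) ^ 2) with hJ
  have hJ0 : 0 ≤ J := intervalIntegral.integral_nonneg hcd fun y _ => by positivity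
  set f : ℂ → ℂ := fun s => L s * exp ((s - w) ^ 2) with hf
  have hfd : ∀ s : ℂ, a ≤ s.re → τ ≤ s.im → DifferentiableAt ℂ f s := fun s h1 h2 =>
    (hdiff s h1 h2).mul (by fun_prop)
  have hfle : ∀ s : ℂ, a ≤ s.re → s.re ≤ b →
      ‖f s‖ ≤ ‖L s‖ * (E * Real.exp (-(s.im - v) ^ 2)) := fun s h1 h2 => by
    rw [hf, norm_mul, norm_exp_sq, hE, ← Real.exp_add]
    gcongr
    simp only [sub_re, sub_im]
    nlinarith
  have hhor : ∀ e : ℝ, τ ≤ e → τ₁ ≤ e → 0 < e → 1 / 9 * e ^ 2 ≤ (e - v) ^ 2 → ∀ x : ℝ,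
      a ≤ x → x ≤ b → ‖f (x + e * I)‖ ≤ E := fun e h1 h2 h0 h3 x hx1 hx2 => by
    have g1 := hfle (x + e * I) (by simpa using hx1) (by simpa using hx2)
    have g2 := hgrowth (x + e * I) (by simpa using hx1) (by simpa using hx2)
      (by simpa using h1.trans (le_abs_self e))
    have g3 := hτ₁ e h2
    simp only [add_im, ofReal_im, mul_im, ofReal_re, I_im, I_re, mul_one, mul_zero, add_zero,
      zero_add] at g1 g2
    rw [abs_of_pos h0] at g2
    have g4 : Real.exp (-(e - v) ^ 2) ≤ Real.exp (-(1 / 9) * e ^ 2) :=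
      Real.exp_le_exp.2 (by linarith)
    calc _ ≤ _ := g1
      _ ≤ ‖L (x + e * I)‖ * (E * Real.exp (-(1 / 9) * e ^ 2)) := by gcongr
      _ ≤ C * e ^ A * (E * Real.exp (-(1 / 9) * e ^ 2)) := by gcongr
      _ = E * (C * e ^ A * Real.exp (-(1 / 9) * e ^ 2)) := by ring
      _ ≤ E * 1 := by gcongr
      _ = E := mul_one _
  have hmain := norm_le_boundary_integral (f := f) (w := w) (a := a) (b := b) (c := v / 2)
    (d := 3 / 2 * v) (by linarith) (by linarith) (by linarith) (by linarith) (fun s hs => by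
      rw [Set.uIcc_of_le hab, Set.uIcc_of_le hcd] at hs
      exact (hfd s hs.1.1 (by linarith [hs.2.1])).differentiableWithinAt)
  have hfw : f w = L w := by simp [hf]
  have hH : ∀ e : ℝ, τ ≤ e → τ₁ ≤ e → 0 < e → 1 / 9 * e ^ 2 ≤ (e - v) ^ 2 →
      ∫ x in a..b, ‖f (x + e * I)‖ ≤ (b - a) * E := fun e h1 h2 h0 h3 => by
    have hi : IntervalIntegrable (fun x : ℝ => ‖f (x + e * I)‖) MeasureTheory.volume a b := by
      refine ContinuousOn.intervalIntegrable fun x hx => ?_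
      rw [Set.uIcc_of_le hab] at hx
      refine ContinuousAt.continuousWithinAt (ContinuousAt.norm ?_)
      exact ContinuousAt.comp (f := fun x : ℝ => (x : ℂ) + e * I)
        (hfd _ (by simpa using hx.1) (by simpa using h1)).continuousAt (by fun_prop)
    calc _ ≤ ∫ _ in a..b, E := intervalIntegral.integral_mono_on hab hi intervalIntegrable_const
          fun x hx => hhor e h1 h2 h0 h3 x hx.1 hx.2
      _ = _ := by simp
  -- Serves both vertical sides: the right one with `B = M`, where the summand 1 in the average
  -- absorbs the bound, and the left one with `B = 1`.
  have hV : ∀ e B : ℝ, a ≤ e → e ≤ b → 0 ≤ B →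
      (∀ y : ℝ, ‖L (e + y * I)‖ ≤ B * (‖L (a + y * I)‖ + 1)) →
      ∫ y in (v / 2)..(3 / 2 * v), ‖f (e + y * I)‖ ≤ B * E * J := fun e B h1 h2 hB h3 => by
    have hi : IntervalIntegrable (fun y : ℝ => ‖f (e + y * I)‖) MeasureTheory.volume
        (v / 2) (3 / 2 * v) := by
      refine ContinuousOn.intervalIntegrable fun y hy => ?_
      rw [Set.uIcc_of_le hcd] at hy
      refine ContinuousAt.continuousWithinAt (ContinuousAt.norm ?_)
      exact ContinuousAt.comp (f := fun y : ℝ => (e : ℂ) + y * I)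
        (hfd _ (by simpa using h1) (by simp; linarith [hy.1])).continuousAt (by fun_prop)
    rw [hJ, ← intervalIntegral.integral_const_mul]
    refine intervalIntegral.integral_mono_on hcd hi
      ((((hcont.norm.add continuous_const).mul (by fun_prop)).const_mul _).intervalIntegrable _ _)
      fun y hy => ?_
    have g1 := hfle (e + y * I) (by simpa using h1) (by simpa using h2)
    simp only [add_im, ofReal_im, mul_im, ofReal_re, I_im, I_re, mul_one, mul_zero, add_zero,
      zero_add] at g1
    calc _ ≤ _ := g1
      _ ≤ B * (‖L (a + y * I)‖ + 1) * (E * Real.exp (-(y - v) ^ 2)) := by gcongr; exact h3 y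
      _ = _ := by ring
  have b1 := hH (v / 2) (by linarith) (by linarith) (by linarith) (by nlinarith)
  have b2 := hH (3 / 2 * v) (by linarith) (by linarith) (by linarith) (by nlinarith)
  have b3 := hV b M hab le_rfl hM fun y => (hright y).trans
    (le_mul_of_one_le_right hM (by linarith [norm_nonneg (L (a + y * I))]))
  have b4 := hV a 1 le_rfl hab zero_le_one fun y => by linarith
  rw [one_mul] at b4
  have hm' : m ≤ (b - w.re) / ((b - w.re) ^ 2 + 1) := by
    rw [hm]
    have q1 : b - w.re ≤ b - a := by linarith
    have q2 : 0 < b - w.re := by linarith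
    gcongr
  rw [hfw] at hmain
  have c1 : (b - w.re)⁻¹ * (∫ y in (v / 2)..(3 / 2 * v), ‖f (b + y * I)‖)
      ≤ (b - σ₂)⁻¹ * (M * E * J) := by
    gcongr
    exact intervalIntegral.integral_nonneg hcd fun y _ => norm_nonneg _
  have c2 : (w.re - a)⁻¹ * (∫ y in (v / 2)..(3 / 2 * v), ‖f (a + y * I)‖)
      ≤ (σ₁ - a)⁻¹ * (E * J) := by
    gcongr
    exact intervalIntegral.integral_nonneg hcd fun y _ => norm_nonneg _
  have c3 : m * ‖L w‖ ≤ K₁ + K₂ * J := by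
    have : m * ‖L w‖ ≤ (b - w.re) / ((b - w.re) ^ 2 + 1) * ‖L w‖ := by gcongr
    rw [hK₁, hK₂]
    refine this.trans (hmain.trans ?_)
    rw [add_mul, mul_assoc (b - σ₂)⁻¹, mul_assoc (σ₁ - a)⁻¹, ← add_assoc]
    exact add_le_add (add_le_add (add_le_add b1 b2) c1) c2
  rw [div_mul_eq_mul_div, le_div_iff₀ hmpos]
  calc ‖L w‖ * m = m * ‖L w‖ := mul_comm _ _
    _ ≤ K₁ + K₂ * J := c3
    _ ≤ (K₁ + K₂ * J) + (K₂ + K₁ * J) := le_add_of_nonneg_right (by positivity)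
    _ = _ := by ring

/-- Variant of `exists_norm_le_local_average` with averages centred at a nearby height. -/
theorem exists_norm_le_centred_average {L : ℂ → ℂ} {a b σ₁ σ₂ τ A C M : ℝ} (ha : a < σ₁)
    (h12 : σ₁ ≤ σ₂) (hb : σ₂ < b)
    (hdiff : ∀ s : ℂ, a ≤ s.re → τ ≤ s.im → DifferentiableAt ℂ L s)
    (hgrowth : ∀ s : ℂ, a ≤ s.re → s.re ≤ b → τ ≤ |s.im| → ‖L s‖ ≤ C * |s.im| ^ A)
    (hright : ∀ y : ℝ, ‖L (b + y * I)‖ ≤ M)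
    (hcont : Continuous fun y : ℝ => L (a + y * I)) {h : ℝ} (hh : 0 ≤ h) :
    ∃ K x₀ : ℝ, 0 ≤ K ∧ ∀ x : ℝ, x₀ ≤ x → ∀ w : ℂ, σ₁ ≤ w.re → w.re ≤ σ₂ → |w.im - x| ≤ h →
      ‖L w‖ ≤ K * (1 + ∫ y in (0 : ℝ)..(2 * x),
        (‖L (a + y * I)‖ + 1) * Real.exp (-|y - x|)) := by
  obtain ⟨K, y₀, hK, hbound⟩ :=
    exists_norm_le_local_average ha h12 hb hdiff hgrowth hright hcont
  -- From |y - x| ≤ |y - Im w| + h and u ≤ u² + 1 the Gaussian is at most exp(1 + h) exp(-|y - x|).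
  -- The condition x ≥ 3h gives (3/2) Im w ≤ 2x.
  refine ⟨K * Real.exp (1 + h), max (y₀ + h) (3 * h), by positivity,
    fun x hx w hw1 hw2 hw3 => ?_⟩
  have hx1 : y₀ + h ≤ x := (le_max_left _ _).trans hx
  have hx2 : 3 * h ≤ x := (le_max_right _ _).trans hx
  have hw4 := abs_le.1 hw3
  refine (hbound w hw1 hw2 (by linarith)).trans ?_
  rw [mul_assoc]
  gcongr
  rw [mul_add, mul_one]
  have hcont' : ∀ g : ℝ → ℝ, Continuous g →
      Continuous fun y : ℝ => (‖L (a + y * I)‖ + 1) * g y := fun g hg =>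
    (hcont.norm.add continuous_const).mul hg
  refine add_le_add (Real.one_le_exp (by linarith)) ?_
  calc _ ≤ ∫ y in (w.im / 2)..(3 / 2 * w.im),
          Real.exp (1 + h) * ((‖L (a + y * I)‖ + 1) * Real.exp (-|y - x|)) := by
        refine intervalIntegral.integral_mono_on (by linarith)
          ((hcont' _ (by fun_prop)).intervalIntegrable _ _)
          (((hcont' _ (by fun_prop)).const_mul _).intervalIntegrable _ _) fun y _ => ?_
        rw [mul_left_comm, ← Real.exp_add]
        gcongr
        have h1 : |y - x| ≤ |y - w.im| + |w.im - x| := abs_sub_le _ _ _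
        nlinarith [sq_nonneg (|y - w.im| - 1 / 2), sq_abs (y - w.im)]
    _ = Real.exp (1 + h) * ∫ y in (w.im / 2)..(3 / 2 * w.im),
          (‖L (a + y * I)‖ + 1) * Real.exp (-|y - x|) := intervalIntegral.integral_const_mul _ _
    _ ≤ _ := by
        gcongr
        refine intervalIntegral.integral_mono_interval (by linarith) (by linarith) (by linarith)
          (Eventually.of_forall fun y => ?_) ((hcont' _ (by fun_prop)).intervalIntegrable _ _)
        show 0 ≤ (‖L (a + y * I)‖ + 1) * Real.exp (-|y - x|)
        positivity

/-! ### Summing the local averages -/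

theorem summable_exp_neg_abs_int : Summable fun j : ℤ => Real.exp (-|(j : ℝ)|) := by
  refine Summable.of_nat_of_neg ?_ ?_
  · simpa using Real.summable_exp_neg_nat
  · simpa using Real.summable_exp_neg_nat

/-- Replacing u by its floor costs a factor e at most, and the rest is part of a convergent sum over
the integers, so the bound is uniform in u. -/
theorem exists_sum_exp_neg_abs_sub_le :
    ∃ B : ℝ, 0 ≤ B ∧ ∀ (u : ℝ) (t : Finset ℕ), ∑ n ∈ t, Real.exp (-|u - n|) ≤ B := by
  refine ⟨Real.exp 1 * ∑' j : ℤ, Real.exp (-|(j : ℝ)|),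
    mul_nonneg (Real.exp_pos _).le (tsum_nonneg fun j => (Real.exp_pos _).le), fun u t => ?_⟩
  have hinj : Function.Injective fun n : ℕ => ⌊u⌋ - (n : ℤ) := fun m n h => by
    simp only at h; omega
  calc _ ≤ ∑ n ∈ t, Real.exp 1 * Real.exp (-|((⌊u⌋ - (n : ℤ) : ℤ) : ℝ)|) := by
        refine Finset.sum_le_sum fun n _ => ?_
        rw [← Real.exp_add]
        gcongr
        have h1 : |(⌊u⌋ : ℝ) - n| ≤ |(⌊u⌋ : ℝ) - u| + |u - n| := abs_sub_le _ _ _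
        have h2 : |(⌊u⌋ : ℝ) - u| ≤ 1 := by
          rw [abs_le]; constructor <;> linarith [Int.floor_le u, Int.lt_floor_add_one u]
        push_cast
        linarith
    _ = Real.exp 1 * ∑ n ∈ t, Real.exp (-|((⌊u⌋ - (n : ℤ) : ℤ) : ℝ)|) := (Finset.mul_sum _ _ _).symm
    _ ≤ _ := by
        gcongr
        have hs := summable_exp_neg_abs_int.comp_injective hinj
        refine (hs.sum_le_tsum t fun _ _ => (Real.exp_pos _).le).trans ?_
        exact tsum_comp_le_tsum_of_inj summable_exp_neg_abs_int (fun j => (Real.exp_pos _).le) hinj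

/-- After enlarging all ranges to [0, 2N] and exchanging sum and integral, each height carries a
bounded total weight. -/
theorem exists_sum_average_le :
    ∃ B : ℝ, 0 ≤ B ∧ ∀ g : ℝ → ℝ, Continuous g → (∀ y, 0 ≤ g y) → ∀ N : ℕ,
      ∑ n ∈ Finset.range N, ∫ y in (0 : ℝ)..(2 * n), g y * Real.exp (-|y - n|)
        ≤ B * ∫ y in (0 : ℝ)..(2 * N), g y := by
  obtain ⟨B, hB, hsum⟩ := exists_sum_exp_neg_abs_sub_le
  refine ⟨B, hB, fun g hg hg0 N => ?_⟩
  have hc : ∀ n : ℕ, Continuous fun y : ℝ => g y * Real.exp (-|y - n|) := fun n => by fun_prop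
  calc _ ≤ ∑ n ∈ Finset.range N, ∫ y in (0 : ℝ)..(2 * N), g y * Real.exp (-|y - n|) := by
        refine Finset.sum_le_sum fun n hn => ?_
        have hn' : (n : ℝ) ≤ N := by exact_mod_cast (Finset.mem_range.1 hn).le
        refine intervalIntegral.integral_mono_interval le_rfl (by positivity) (by linarith)
          (Eventually.of_forall fun y => mul_nonneg (hg0 y) (Real.exp_pos _).le)
          ((hc n).intervalIntegrable _ _)
    _ = ∫ y in (0 : ℝ)..(2 * N), ∑ n ∈ Finset.range N, g y * Real.exp (-|y - n|) :=
        (intervalIntegral.integral_finsetSum fun n _ => (hc n).intervalIntegrable _ _).symm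
    _ ≤ ∫ y in (0 : ℝ)..(2 * N), B * g y := by
        refine intervalIntegral.integral_mono_on (by positivity)
          ((continuous_finsetSum _ fun n _ => hc n).intervalIntegrable _ _)
          ((hg.const_mul B).intervalIntegrable _ _) fun y _ => ?_
        rw [← Finset.mul_sum, mul_comm B]
        exact mul_le_mul_of_nonneg_left (hsum y _) (hg0 y)
    _ = _ := intervalIntegral.integral_const_mul _ _

/-- A mean square bound makes the sum of the local averages linear in the height. -/
theorem exists_sum_average_le_mul {g : ℝ → ℝ} (hg : Continuous g) (hg0 : ∀ y, 0 ≤ g y)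
    (hmean : (fun T : ℝ => ∫ t in (0 : ℝ)..T, g t ^ 2) =O[atTop] (fun T : ℝ => T)) :
    ∃ (D : ℝ) (N₀ : ℕ), 0 ≤ D ∧ ∀ N : ℕ, N₀ ≤ N →
      ∑ n ∈ Finset.range N, ∫ y in (0 : ℝ)..(2 * n), (g y + 1) * Real.exp (-|y - n|)
        ≤ D * N := by
  obtain ⟨B, hB, hsum⟩ := exists_sum_average_le
  obtain ⟨c, hc, hbound⟩ := hmean.exists_nonneg
  obtain ⟨T₀, hT₀⟩ := eventually_atTop.1 hbound.bound
  -- On [0, 2N] the integrand g + 1 is at most 2 + g², whose integral is at most 4N + 2cN.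
  refine ⟨B * (4 + 2 * c), ⌈T₀⌉₊, by positivity, fun N hN => ?_⟩
  have hN' : T₀ ≤ N := (Nat.le_ceil T₀).trans (by exact_mod_cast hN)
  have hN0 : (0 : ℝ) ≤ N := by positivity
  refine (hsum (fun y => g y + 1) (by fun_prop) (fun y => by linarith [hg0 y]) N).trans ?_
  rw [mul_assoc]
  gcongr
  have h1 := hT₀ (2 * N) (by linarith)
  rw [Real.norm_of_nonneg (by positivity : (0 : ℝ) ≤ 2 * N)] at h1
  have h2 := (le_abs_self _).trans h1
  calc _ ≤ ∫ y in (0 : ℝ)..(2 * N), (2 + g y ^ 2) := by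
        refine intervalIntegral.integral_mono_on (by positivity)
          (Continuous.intervalIntegrable (by fun_prop) _ _)
          (Continuous.intervalIntegrable (by fun_prop) _ _) fun y _ => ?_
        nlinarith [sq_nonneg (g y - 1), hg0 y]
    _ = 2 * N * 2 + ∫ y in (0 : ℝ)..(2 * N), g y ^ 2 := by
        rw [intervalIntegral.integral_add (Continuous.intervalIntegrable (by fun_prop) _ _)
          (Continuous.intervalIntegrable (by fun_prop) _ _)]
        simp
    _ ≤ _ := by linarith

/-! ### Counting zeros: divisors, Jensen's formula, covering by discs -/

section Zeros

variable {F : ℂ → ℂ}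

theorem zeroMult_eq_zero_of_order_eq_zero {z : ℂ} (h : meromorphicOrderAt F z = 0) :
    zeroMult F z = 0 := by
  rw [zeroMult, h]; rfl

theorem meromorphicOrderAt_eq_zero_of_analyticAt {z : ℂ} (hF : AnalyticAt ℂ F z) (h : F z ≠ 0) :
    meromorphicOrderAt F z = 0 := by
  rw [hF.meromorphicOrderAt_eq, hF.analyticOrderAt_eq_zero.2 h]; rfl

theorem zeroMult_eq_toNat_divisor {K : Set ℂ} (hF : MeromorphicOn F K) {z : ℂ} (hz : z ∈ K)
    (h : meromorphicOrderAt F z ≠ ⊤) :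
    zeroMult F z = ((MeromorphicOn.divisor F K z).toNat : ℕ∞) := by
  rw [hF.divisor_apply hz, zeroMult]
  obtain ⟨k, hk⟩ := WithTop.ne_top_iff_exists.1 h
  rw [← hk]
  rfl

/-- On a compact set the number of zeros is a finite sum over the support of the divisor. -/
theorem tsum_zeroMult_eq_sum_divisor {K : Set ℂ} (hK : IsCompact K) (hF : MeromorphicOn F K)
    (h : ∀ z ∈ K, meromorphicOrderAt F z ≠ ⊤) :
    ∑' ρ : K, ((zeroMult F ρ : ℕ∞) : ℝ≥0∞) =
      ∑ u ∈ ((MeromorphicOn.divisor F K).finiteSupport hK).toFinset,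
        (((MeromorphicOn.divisor F K u).toNat : ℕ) : ℝ≥0∞) := by
  rw [tsum_subtype K fun ρ => ((zeroMult F ρ : ℕ∞) : ℝ≥0∞)]
  have hind : K.indicator (fun ρ => ((zeroMult F ρ : ℕ∞) : ℝ≥0∞))
      = fun u => (((MeromorphicOn.divisor F K u).toNat : ℕ) : ℝ≥0∞) := by
    funext u
    by_cases hu : u ∈ K
    · rw [Set.indicator_of_mem hu, zeroMult_eq_toNat_divisor hF hu (h u hu)]
      rfl
    · rw [Set.indicator_of_notMem hu, Function.locallyFinsuppWithin.apply_eq_zero_of_notMem _ hu]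
      simp
  rw [hind]
  refine tsum_eq_sum fun u hu => ?_
  have : MeromorphicOn.divisor F K u = 0 := by simpa using hu
  simp [this]

theorem tsum_zeroMult_ne_top {K : Set ℂ} (hK : IsCompact K) (hF : MeromorphicOn F K)
    (h : ∀ z ∈ K, meromorphicOrderAt F z ≠ ⊤) :
    ∑' ρ : K, ((zeroMult F ρ : ℕ∞) : ℝ≥0∞) ≠ ⊤ := by
  rw [tsum_zeroMult_eq_sum_divisor hK hF h]
  exact ENNReal.sum_ne_top.2 fun u _ => ENNReal.natCast_ne_top _

/-- Jensen's bound for the number of zeros in a disc, counted with multiplicity. -/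
theorem tsum_zeroMult_closedBall_le {c : ℂ} {r R M : ℝ} (hr : 0 < r) (hrR : r < R) (hM : 1 ≤ M)
    (hF : AnalyticOnNhd ℂ F (Metric.closedBall c R)) (h0 : F c ≠ 0)
    (hb : ∀ z ∈ Metric.sphere c R, ‖F z‖ ≤ M) :
    ∑' ρ : Metric.closedBall c r, ((zeroMult F ρ : ℕ∞) : ℝ≥0∞)
      ≤ ENNReal.ofReal (Real.log (M / ‖F c‖) / Real.log (R / r)) := by
  have hR : 0 < R := hr.trans hrR
  have hF' : AnalyticOnNhd ℂ F (Metric.closedBall c r) :=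
    hF.mono (Metric.closedBall_subset_closedBall hrR.le)
  have hcr : c ∈ Metric.closedBall c r := Metric.mem_closedBall_self hr.le
  have hord : ∀ z ∈ Metric.closedBall c r, meromorphicOrderAt F z ≠ ⊤ := fun z hz => by
    refine hF'.meromorphicOn.meromorphicOrderAt_ne_top_of_isPreconnected
      (convex_closedBall c r).isPreconnected hcr hz ?_
    rw [meromorphicOrderAt_eq_zero_of_analyticAt (hF' c hcr) h0]
    exact WithTop.zero_ne_top
  have hJ := AnalyticOnNhd.sum_divisor_le (c := c) (r := r) (R := R) (M := M) (f := F)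
    (by rwa [abs_of_pos hr]) (by rwa [abs_of_pos hr, abs_of_pos hR]) hM
    (by rwa [abs_of_pos hR]) h0 (by rwa [abs_of_pos hR])
  rw [abs_of_pos hr] at hJ
  have hK := isCompact_closedBall c r
  rw [tsum_zeroMult_eq_sum_divisor hK hF'.meromorphicOn hord]
  refine le_trans (le_of_eq ?_) (ENNReal.ofReal_le_ofReal hJ)
  have hnn : ∀ u, 0 ≤ MeromorphicOn.divisor F (Metric.closedBall c r) u := fun u =>
    MeromorphicOn.AnalyticOnNhd.divisor_nonneg hF' u
  rw [finsum_eq_sum _ ((MeromorphicOn.divisor F (Metric.closedBall c r)).finiteSupport hK),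
    Int.cast_sum, ENNReal.ofReal_sum_of_nonneg fun u _ => by exact_mod_cast hnn u]
  refine Finset.sum_congr rfl fun u _ => ?_
  obtain ⟨k, hk⟩ := Int.eq_ofNat_of_zero_le (hnn u)
  simp [hk]

/-- Covering the region of `zeroCount` by discs, up to a compact part and a zero-free half-plane. -/
theorem exists_zeroCount_le_sum (hF : MeromorphicOn F rightHalfPlane)
    (hord : ∀ z ∈ rightHalfPlane, meromorphicOrderAt F z ≠ ⊤) {σ₀ X r : ℝ} (hσ₀ : 1 / 2 < σ₀)
    (hr : 0 ≤ r) (hright : ∀ s : ℂ, X ≤ s.re → meromorphicOrderAt F s = 0)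
    (hXr : (X - σ₀) ^ 2 + 1 ≤ r ^ 2) {n₀ : ℕ} {β : ℕ → ℝ} (hβ0 : ∀ n, 0 ≤ β n)
    (hβ : ∀ n, n₀ ≤ n → ∑' ρ : Metric.closedBall ((X : ℂ) + n * I) r,
      ((zeroMult F ρ : ℕ∞) : ℝ≥0∞) ≤ ENNReal.ofReal (β n)) :
    ∃ κ : ℝ, 0 ≤ κ ∧ ∀ T : ℝ,
      zeroCount F σ₀ T ≤ ENNReal.ofReal (κ + ∑ n ∈ Finset.range ⌈T⌉₊, β n) := by
  -- The low part of the region, where poles may lie: finitely many zeros, counted once and for all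
  -- by `κ`.
  set K : Set ℂ := Set.Icc σ₀ X ×ℂ Set.Icc 0 n₀ with hK
  have hKc : IsCompact K := isCompact_Icc.reProdIm isCompact_Icc
  have hKsub : K ⊆ rightHalfPlane := fun z hz => lt_of_lt_of_le hσ₀ hz.1.1
  have hKfin := tsum_zeroMult_ne_top hKc (hF.mono_set hKsub) fun z hz => hord z (hKsub hz)
  set κ := ∑' ρ : K, ((zeroMult F ρ : ℕ∞) : ℝ≥0∞) with hκ
  refine ⟨κ.toReal, ENNReal.toReal_nonneg, fun T => ?_⟩
  set H : Set ℂ := {s | X ≤ s.re} with hH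
  set B : ℕ → Set ℂ := fun n => Metric.closedBall ((X : ℂ) + n * I) r with hB
  set N := ⌈T⌉₊ with hN
  have hsub : {ρ : ℂ | σ₀ < ρ.re ∧ 0 < ρ.im ∧ ρ.im < T} ⊆
      H ∪ (K ∪ ⋃ n ∈ Finset.Ico n₀ N, B n) := by
    rintro ρ ⟨h1, h2, h3⟩
    rcases le_or_gt X ρ.re with hX | hX
    · exact Or.inl hX
    refine Or.inr ?_
    rcases le_or_gt ρ.im n₀ with hn | hn
    · exact Or.inl ⟨⟨h1.le, hX.le⟩, ⟨h2.le, hn⟩⟩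
    refine Or.inr ?_
    simp only [Set.mem_iUnion, Finset.mem_Ico]
    have hfl := Nat.floor_le h2.le
    have hfl' := Nat.lt_floor_add_one ρ.im
    -- The disc at height ⌊Im ρ⌋ contains ρ: the vertical offset is below 1 and the horizontal one
    -- below X - σ₀.
    refine ⟨⌊ρ.im⌋₊, ⟨Nat.le_floor hn.le, ?_⟩, ?_⟩
    · rw [hN]
      exact_mod_cast hfl.trans_lt (h3.trans_le (Nat.le_ceil T))
    · rw [hB, mem_closedBall_iff_norm, ← sq_le_sq₀ (norm_nonneg _) hr, Complex.sq_norm,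
        normSq_apply]
      simp only [sub_re, add_re, ofReal_re, mul_re, I_re, natCast_re, natCast_im, I_im, sub_im,
        add_im, ofReal_im, mul_im]
      nlinarith
  have hHzero : ∑' ρ : H, ((zeroMult F ρ : ℕ∞) : ℝ≥0∞) = 0 := by
    refine ENNReal.tsum_eq_zero.2 fun ρ => ?_
    rw [zeroMult_eq_zero_of_order_eq_zero (hright ρ ρ.2)]
    simp
  set m : ℂ → ℝ≥0∞ := fun ρ => ((zeroMult F ρ : ℕ∞) : ℝ≥0∞) with hm
  calc zeroCount F σ₀ T ≤ ∑' ρ : ↑(H ∪ (K ∪ ⋃ n ∈ Finset.Ico n₀ N, B n)), m ρ :=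
        ENNReal.tsum_mono_subtype m hsub
    _ ≤ 0 + (κ + ∑ n ∈ Finset.Ico n₀ N, ∑' ρ : B n, m ρ) := by
        refine (ENNReal.tsum_union_le m _ _).trans (add_le_add hHzero.le ?_)
        refine (ENNReal.tsum_union_le m _ _).trans (add_le_add le_rfl ?_)
        exact ENNReal.tsum_biUnion_le m _ _
    _ ≤ 0 + (κ + ∑ n ∈ Finset.Ico n₀ N, ENNReal.ofReal (β n)) := by
        gcongr with n hn
        exact hβ n (Finset.mem_Ico.1 hn).1
    _ ≤ 0 + (κ + ∑ n ∈ Finset.range N, ENNReal.ofReal (β n)) := by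
        gcongr
        exact fun n hn => Finset.mem_range.2 (Finset.mem_Ico.1 hn).2
    _ = _ := by
        rw [zero_add, ENNReal.ofReal_add ENNReal.toReal_nonneg
          (Finset.sum_nonneg fun n _ => hβ0 n), ENNReal.ofReal_toReal hKfin,
          ENNReal.ofReal_sum_of_nonneg fun n _ => hβ0 n]

end Zeros

/-! ### Analytic properties of P(L) -/

section PolyComp

variable {P : Polynomial (ℂ → ℂ)} {L : ℂ → ℂ}

theorem isOpen_rightHalfPlane : IsOpen rightHalfPlane :=
  isOpen_lt continuous_const continuous_re

theorem isPreconnected_rightHalfPlane : IsPreconnected rightHalfPlane :=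
  (convex_halfSpace_re_gt _).isPreconnected

theorem differentiableOn_polyComp (hP : ∀ k, IsAbsConvGDS (P.coeff k)) {U : Set ℂ}
    (hU : U ⊆ rightHalfPlane) (hL : DifferentiableOn ℂ L U) :
    DifferentiableOn ℂ (polyComp P L) U := by
  rw [show polyComp P L = _ from funext (polyComp_eq_sum P L)]
  exact DifferentiableOn.fun_sum fun k _ =>
    ((hP k).differentiableOn.mono hU).fun_mul (hL.fun_pow k)

theorem meromorphicOn_polyComp (hP : ∀ k, IsAbsConvGDS (P.coeff k))
    (hL : MeromorphicOn L rightHalfPlane) : MeromorphicOn (polyComp P L) rightHalfPlane := by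
  rw [show polyComp P L = _ from funext (polyComp_eq_sum P L)]
  intro z hz
  refine MeromorphicAt.fun_sum fun k _ => ?_
  have hk := (hP k).differentiableOn.analyticAt (isOpen_rightHalfPlane.mem_nhds hz)
  exact hk.meromorphicAt.fun_mul ((hL z hz).fun_pow k)

theorem isEventuallyGDS_polyComp (hP : ∀ k, IsAbsConvGDS (P.coeff k))
    (hL : IsDirichletSeriesRightOfOne L) : IsEventuallyGDS (polyComp P L) := by
  rw [show polyComp P L = _ from funext (polyComp_eq_sum P L)]
  obtain ⟨a, lam, σ, hw, h⟩ := hL.exists_hasSum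
  have hL' : IsEventuallyGDS L := ⟨ℕ, a, lam, σ, hw.isPWO, h⟩
  exact IsEventuallyGDS.sum _ fun k _ => (hP k).isEventuallyGDS.mul (hL'.pow k)

theorem exists_norm_polyComp_le (L : ℂ → ℂ) (hP : ∀ k, IsAbsConvGDS (P.coeff k)) {σ₁ : ℝ}
    (hσ₁ : 1 / 2 < σ₁) (σ₂ : ℝ) :
    ∃ Q : ℝ, 1 ≤ Q ∧ ∀ s : ℂ, σ₁ ≤ s.re → s.re ≤ σ₂ →
      ‖polyComp P L s‖ ≤ Q * (1 + ‖L s‖) ^ P.natDegree := by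
  have hcoeff : ∀ k, ∃ M : ℝ, ∀ s : ℂ, σ₁ ≤ s.re → s.re ≤ σ₂ → ‖P.coeff k s‖ ≤ M := fun k => by
    obtain ⟨a, lam, -, h⟩ := hP k
    exact exists_norm_le_of_hasSum_gds h hσ₁ σ₂
  choose M hM using hcoeff
  refine ⟨1 + ∑ k ∈ Finset.range (P.natDegree + 1), |M k|,
    le_add_of_nonneg_right (Finset.sum_nonneg fun k _ => abs_nonneg _), fun s h1 h2 => ?_⟩
  rw [polyComp_eq_sum]
  have hL1 : 1 ≤ 1 + ‖L s‖ := le_add_of_nonneg_right (norm_nonneg _)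
  calc _ ≤ ∑ k ∈ Finset.range (P.natDegree + 1), |M k| * (1 + ‖L s‖) ^ P.natDegree := by
        refine norm_sum_le_of_le _ fun k hk => ?_
        rw [norm_mul, norm_pow]
        refine mul_le_mul ((hM k s h1 h2).trans (le_abs_self _)) ?_ (by positivity) (abs_nonneg _)
        calc ‖L s‖ ^ k ≤ (1 + ‖L s‖) ^ k := by gcongr; linarith
          _ ≤ _ := pow_le_pow_right₀ hL1 (Nat.lt_succ_iff.1 (Finset.mem_range.1 hk))
    _ = (∑ k ∈ Finset.range (P.natDegree + 1), |M k|) * (1 + ‖L s‖) ^ P.natDegree :=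
        (Finset.sum_mul _ _ _).symm
    _ ≤ _ := by gcongr; linarith

end PolyComp

/-! ### Zeros in one disc, and the final count -/

/-- The lower bound at the centres and the upper bound by local averages give, via Jensen's
formula, a bound for the number of zeros in a disc. -/
theorem exists_tsum_zeroMult_closedBall_le {F L : ℂ → ℂ} {a X r R K x₀ Q c : ℝ} {d : ℕ}
    (hr : 0 < r) (hrR : r < R) (hK : 0 ≤ K) (hQ : 1 ≤ Q) (hc : 0 < c)
    (hF : ∀ x : ℝ, x₀ ≤ x → AnalyticOnNhd ℂ F (Metric.closedBall ((X : ℂ) + x * I) R))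
    (hlow : ∀ x : ℝ, c ≤ ‖F ((X : ℂ) + x * I)‖)
    (hup : ∀ s : ℂ, X - R ≤ s.re → s.re ≤ X + R → ‖F s‖ ≤ Q * (1 + ‖L s‖) ^ d)
    (hL : ∀ x : ℝ, x₀ ≤ x → ∀ w : ℂ, X - R ≤ w.re → w.re ≤ X + R → |w.im - x| ≤ R →
      ‖L w‖ ≤ K * (1 + ∫ y in (0 : ℝ)..(2 * x), (‖L (a + y * I)‖ + 1) * Real.exp (-|y - x|))) :
    ∃ E₀ E₁ : ℝ, 0 ≤ E₀ ∧ 0 ≤ E₁ ∧ ∀ x : ℝ, x₀ ≤ x → 0 ≤ x →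
      ∑' ρ : Metric.closedBall ((X : ℂ) + x * I) r, ((zeroMult F ρ : ℕ∞) : ℝ≥0∞)
        ≤ ENNReal.ofReal (E₀ + E₁ *
          ∫ y in (0 : ℝ)..(2 * x), (‖L (a + y * I)‖ + 1) * Real.exp (-|y - x|)) := by
  have hlog : 0 < Real.log (R / r) := Real.log_pos ((one_lt_div hr).2 hrR)
  -- From log M ≤ log Q + dK(1 + J): the degree enters only as a factor, so no higher moment of L is
  -- needed.
  refine ⟨(|Real.log Q - Real.log c| + d * K) / Real.log (R / r), d * K / Real.log (R / r),
    by positivity, by positivity, fun x hx hx0 => ?_⟩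
  set J := ∫ y in (0 : ℝ)..(2 * x), (‖L (a + y * I)‖ + 1) * Real.exp (-|y - x|) with hJ
  have hJ0 : 0 ≤ J := intervalIntegral.integral_nonneg (by linarith) fun y _ => by positivity
  have hKJ : 0 ≤ K * (1 + J) := by positivity
  set M := Q * (1 + K * (1 + J)) ^ d with hM
  have hpow : 1 ≤ (1 + K * (1 + J)) ^ d := one_le_pow₀ (by linarith)
  have hM1 : 1 ≤ M := one_le_mul_of_one_le_of_one_le hQ hpow
  have hF0 : 0 < ‖F ((X : ℂ) + x * I)‖ := hc.trans_le (hlow x)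
  refine (tsum_zeroMult_closedBall_le hr hrR hM1 (hF x hx) (norm_pos_iff.1 hF0)
    fun z hz => ?_).trans (ENNReal.ofReal_le_ofReal ?_)
  · have hz' : ‖z - (X + x * I)‖ = R := by simpa [dist_eq_norm] using hz
    have h1 : |z.re - X| ≤ R := by
      rw [← hz']; simpa using abs_re_le_norm (z - (X + x * I))
    have h2 : |z.im - x| ≤ R := by
      rw [← hz']; simpa using abs_im_le_norm (z - (X + x * I))
    have h1' := abs_le.1 h1
    have h3 : X - R ≤ z.re := by linarith
    have h4 : z.re ≤ X + R := by linarith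
    refine (hup z h3 h4).trans ?_
    rw [hM]
    gcongr
    exact hL x hx z h3 h4 h2
  · rw [div_mul_eq_mul_div, ← add_div]
    have hlogM : Real.log M ≤ Real.log Q + d * (K * (1 + J)) := by
      rw [hM, Real.log_mul (by linarith) (by linarith), Real.log_pow]
      gcongr
      have := Real.log_le_sub_one_of_pos (by linarith : 0 < 1 + K * (1 + J))
      linarith
    have hlogF : Real.log c ≤ Real.log ‖F ((X : ℂ) + x * I)‖ := Real.log_le_log hc (hlow x)
    rw [Real.log_div (by linarith) hF0.ne']
    gcongr
    linarith [le_abs_self (Real.log Q - Real.log c)]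

theorem theorem2
    (L : ℂ → ℂ)
    (hDir : IsDirichletSeriesRightOfOne L)
    (S : Finset ℂ) (hS : ∀ s ∈ S, s.re = 1)
    (hmer : MeromorphicOn L rightHalfPlane)
    (hhol : DifferentiableOn ℂ L (rightHalfPlane \ (S : Set ℂ)))
    (hord : HasFiniteOrder L)
    (hmean : ∀ σ : ℝ, 1 / 2 < σ → σ < 1 →
      (fun T : ℝ => ∫ t in (0 : ℝ)..T, ‖L ((σ : ℂ) + (t : ℂ) * Complex.I)‖ ^ 2)
        =O[atTop] (fun T : ℝ => T))
    (P : Polynomial (ℂ → ℂ)) (hP : ∀ k : ℕ, IsAbsConvGDS (P.coeff k))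
    (hne : ∃ s ∈ rightHalfPlane \ (S : Set ℂ), polyComp P L s ≠ 0)
    (σ₀ : ℝ) (hσ₀ : 1 / 2 < σ₀) :
    ∃ C T₀ : ℝ, ∀ T : ℝ, T₀ ≤ T →
      zeroCount (polyComp P L) σ₀ T ≤ ENNReal.ofReal (C * T) := by
  set F := polyComp P L with hF
  set U : Set ℂ := rightHalfPlane \ (S : Set ℂ) with hU
  have hUo : IsOpen U := isOpen_rightHalfPlane.sdiff S.finite_toSet.isClosed
  have hFan : AnalyticOnNhd ℂ F U :=
    (differentiableOn_polyComp hP Set.sdiff_subset hhol).analyticOnNhd hUo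
  have hFmer : MeromorphicOn F rightHalfPlane := meromorphicOn_polyComp hP hmer
  have hFord : ∀ z ∈ rightHalfPlane, meromorphicOrderAt F z ≠ ⊤ := fun z hz => by
    obtain ⟨s, hs, hFs⟩ := hne
    refine hFmer.meromorphicOrderAt_ne_top_of_isPreconnected isPreconnected_rightHalfPlane
      hs.1 hz ?_
    rw [meromorphicOrderAt_eq_zero_of_analyticAt (hFan s hs) hFs]
    exact WithTop.zero_ne_top
  -- By the identity theorem F has finite order everywhere in the half-plane, so it has nonzero
  -- values arbitrarily far to the right.
  have hfar : ∀ σ : ℝ, ∃ s : ℂ, σ < s.re ∧ F s ≠ 0 := fun σ => by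
    set z : ℂ := ((max σ 1 + 1 : ℝ) : ℂ) with hz
    have hz1 : σ < z.re := by rw [hz, ofReal_re]; linarith [le_max_left σ 1]
    have hz2 : z ∈ rightHalfPlane := by
      show 1 / 2 < z.re
      rw [hz, ofReal_re]; linarith [le_max_right σ 1]
    have h1 := (meromorphicOrderAt_ne_top_iff_eventually_ne_zero (hFmer z hz2)).1 (hFord z hz2)
    have h2 : ∀ᶠ s in 𝓝[≠] z, σ < s.re :=
      nhdsWithin_le_nhds ((isOpen_lt continuous_const continuous_re).mem_nhds hz1)
    exact (h2.and h1).exists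
  obtain ⟨c, μ, σ₂, hc, hlow⟩ := (isEventuallyGDS_polyComp hP hDir).exists_lower_bound hfar
  obtain ⟨aL, lam, σa, -, hLsum⟩ := hDir.exists_hasSum
  -- parameters of the discs
  obtain ⟨δ, hδ, hδ1, hδ0⟩ : ∃ δ : ℝ, 0 < δ ∧ 1 / 2 + 4 * δ ≤ 1 ∧ 1 / 2 + 4 * δ ≤ σ₀ := by
    refine ⟨(min σ₀ 1 - 1 / 2) / 4, ?_, ?_, ?_⟩
    · have : 1 / 2 < min σ₀ 1 := lt_min hσ₀ (by norm_num)
      linarith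
    · linarith [min_le_right σ₀ 1]
    · linarith [min_le_left σ₀ 1]
  -- `σ₂` secures the lower bound at the centres. The term 1/δ + 2 makes the discs flat enough near
  -- their left ends: with r = X - (1/2 + 3δ), the covering condition (r - δ)² + 1 ≤ r² reads 1 + δ²
  -- ≤ 2δr.
  set X := max σ₂ (1 / δ + 2) with hX
  have hX2 : 1 / δ + 2 ≤ X := le_max_right _ _
  have hδinv : 0 < 1 / δ := by positivity
  have hXδ : 1 ≤ δ * (X - 2) := by
    have : δ * (1 / δ) ≤ δ * (X - 2) := by gcongr; linarith
    rwa [mul_one_div_cancel hδ.ne'] at this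
  -- Abscissae spaced by δ: the mean square line at 1/2 + δ, the left ends of the large and small
  -- discs at 1/2 + 2δ and 1/2 + 3δ, and the edge of the counted region at 1/2 + 4δ.
  set a := 1 / 2 + δ with ha
  set R := X - (1 / 2 + 2 * δ) with hR
  set r := X - (1 / 2 + 3 * δ) with hr
  have hr0 : 0 < r := by linarith
  have hrR : r < R := by linarith
  set b := max (X + R) σa + 1 with hb
  have hb1 : X + R < b := by linarith [le_max_left (X + R) σa]
  have hb2 : σa < b := by linarith [le_max_right (X + R) σa]
  obtain ⟨A, C₀, t₀, hgrowth⟩ := hord a b (by linarith)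
  obtain ⟨M, hM⟩ := exists_norm_le_of_hasSum_gds hLsum hb2 b
  -- Adding 1 to the sum of all |Im s| over `S` puts `τ` strictly above every pole.
  set τ := max t₀ (∑ s ∈ S, |s.im| + 1) with hτ
  have hmemU : ∀ s : ℂ, 1 / 2 < s.re → τ ≤ s.im → s ∈ U := fun s h1 h2 => by
    refine ⟨h1, fun hs => ?_⟩
    have h3 := Finset.single_le_sum (f := fun s : ℂ => |s.im|) (fun s _ => abs_nonneg _) hs
    linarith [le_abs_self s.im, le_max_right t₀ (∑ s ∈ S, |s.im| + 1)]
  have hline : ∀ y : ℝ, (a : ℂ) + y * I ∈ U := fun y => by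
    refine ⟨?_, fun hs => ?_⟩
    · show 1 / 2 < ((a : ℂ) + y * I).re
      simp only [add_re, ofReal_re, mul_re, I_re, mul_zero, ofReal_im, zero_mul, sub_self, add_zero]
      linarith
    · have := hS _ hs
      simp only [add_re, ofReal_re, mul_re, I_re, mul_zero, ofReal_im, zero_mul, sub_self,
        add_zero] at this
      linarith
  have hcont : Continuous fun y : ℝ => L (a + y * I) :=
    hhol.continuousOn.comp_continuous (by fun_prop) hline
  have hR0 : 0 < R := hr0.trans hrR
  obtain ⟨K, x₁, hK, hLbound⟩ := exists_norm_le_centred_average (L := L) (a := a) (b := b)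
    (σ₁ := X - R) (σ₂ := X + R) (τ := τ) (A := A) (C := C₀) (M := M) (h := R) (by linarith)
    (by linarith) hb1
    (fun s h1 h2 => hhol.differentiableAt (hUo.mem_nhds (hmemU s (by linarith) h2)))
    (fun s h1 h2 h3 => hgrowth s h1 h2 ((le_max_left _ _).trans h3))
    (fun y => hM _ (by simp) (by simp)) hcont hR0.le
  obtain ⟨Q, hQ, hFup⟩ := exists_norm_polyComp_le L hP (σ₁ := X - R) (by linarith) (X + R)
  set x₀ := max x₁ (τ + R) with hx₀
  obtain ⟨E₀, E₁, hE₀, hE₁, hdisc⟩ := exists_tsum_zeroMult_closedBall_le (F := F) (L := L) (a := a)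
    (X := X) (x₀ := x₀) (c := c * Real.exp (-μ * X)) hr0 hrR hK hQ (by positivity)
    (fun x hx => hFan.mono fun z hz => by
      have hz' : ‖z - (X + x * I)‖ ≤ R := by simpa [dist_eq_norm] using hz
      have h1 : |z.re - X| ≤ R := le_trans (by simpa using abs_re_le_norm (z - (X + x * I))) hz'
      have h2 : |z.im - x| ≤ R := le_trans (by simpa using abs_im_le_norm (z - (X + x * I))) hz'
      have h1' := abs_le.1 h1
      have h2' := abs_le.1 h2
      exact hmemU z (by linarith) (by linarith [le_max_right x₁ (τ + R)]))
    (fun x => by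
      have := hlow (X + x * I) (by simp [hX])
      simpa using this)
    hFup (fun x hx => hLbound x ((le_max_left _ _).trans hx))
  obtain ⟨D, N₀, hD, hsum⟩ := exists_sum_average_le_mul hcont.norm (fun y => norm_nonneg _)
    (hmean a (by linarith) (by linarith))
  set J : ℕ → ℝ := fun n => ∫ y in (0 : ℝ)..(2 * n),
    (‖L (a + y * I)‖ + 1) * Real.exp (-|y - n|) with hJ
  have hJ0 : ∀ n, 0 ≤ J n := fun n =>
    intervalIntegral.integral_nonneg (by positivity) fun y _ => by positivity
  have hzero : ∀ s : ℂ, X ≤ s.re → meromorphicOrderAt F s = 0 := fun s hs => by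
    refine meromorphicOrderAt_eq_zero_of_analyticAt (hFan s ⟨?_, fun h => ?_⟩) ?_
    · show 1 / 2 < s.re
      linarith
    · have := hS s h
      linarith
    · have := hlow s ((le_max_left _ _).trans hs)
      exact norm_pos_iff.1 (lt_of_lt_of_le (by positivity) this)
  obtain ⟨κ, hκ, hcount⟩ := exists_zeroCount_le_sum hFmer hFord (σ₀ := 1 / 2 + 4 * δ) (X := X)
    (r := r) (n₀ := ⌈x₀⌉₊) (β := fun n => E₀ + E₁ * J n) (by linarith) hr0.le hzero
    (by nlinarith) (fun n => by have := hJ0 n; positivity)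
    (fun n hn => by
      have := hdisc n ((Nat.le_ceil x₀).trans (by exact_mod_cast hn)) (by positivity)
      simpa using this)
  refine ⟨κ + 2 * (E₀ + E₁ * D), max 1 N₀, fun T hT => ?_⟩
  have hT1 : 1 ≤ T := (le_max_left _ _).trans hT
  have hTN : (N₀ : ℝ) ≤ T := (le_max_right _ _).trans hT
  have hmono : zeroCount F σ₀ T ≤ zeroCount F (1 / 2 + 4 * δ) T :=
    ENNReal.tsum_mono_subtype (fun ρ => ((zeroMult F ρ : ℕ∞) : ℝ≥0∞))
      (s := {ρ : ℂ | σ₀ < ρ.re ∧ 0 < ρ.im ∧ ρ.im < T})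
      (t := {ρ : ℂ | 1 / 2 + 4 * δ < ρ.re ∧ 0 < ρ.im ∧ ρ.im < T})
      fun ρ hρ => ⟨hδ0.trans_lt hρ.1, hρ.2⟩
  refine hmono.trans ((hcount T).trans (ENNReal.ofReal_le_ofReal ?_))
  have hN := hsum ⌈T⌉₊ (by exact_mod_cast hTN.trans (Nat.le_ceil T))
  have hceil : (⌈T⌉₊ : ℝ) ≤ 2 * T := by linarith [Nat.ceil_lt_add_one (by linarith : 0 ≤ T)]
  rw [Finset.sum_add_distrib, ← Finset.mul_sum, Finset.sum_const, Finset.card_range, nsmul_eq_mul]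
  calc κ + (⌈T⌉₊ * E₀ + E₁ * ∑ n ∈ Finset.range ⌈T⌉₊, J n)
      ≤ κ * T + (2 * T * E₀ + E₁ * (D * (2 * T))) := by
        gcongr
        · exact le_mul_of_one_le_right hκ hT1
        · exact hN.trans (by gcongr)
    _ = _ := by ring
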